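/- **Index coding.** An instance $\mathcal I=(X,R)$ of the Index Coding problem consists of a finite set $X$ of messages and a set $R$ of clients $(x,H)$ with $x\in X$, $H\subseteq X\setminus\{x\}$; the client $(x,H)$ has the messages in $H$ and wants $x$. For $n\ge 1$ and an alphabet $\Sigma$, each message is a vector in $\Sigma^n$. An index code with $\ell$ transmissions is a map $f:(\Sigma^n)^X\to\Sigma^\ell$ such that for every client $r=(x,H)\in R$ there is a decoding function $\psi_r$ that recovers the value of the message $x$ from the output of $f$ and the values of the messages in $H$. If $\Sigma$ is a finite field and $f$ and all $\psi_r$ are linear over $\Sigma$, the index code is (vector) linear. Let $\lambda(n,q)=\ell(n,q)/n$, where $\ell(n,q)$ is the least $\ell$ for which an index code with $|\Sigma|=q$ exists, and let $\lambda^*(n,q)=\ell^*(n,q)/n$, where $\ell^*(n,q)$ is the least $\ell$ for which a linear index code over $\Sigma=\mathbb F_q$ exists. Let $\mu(\mathcal I)=\max_{H\subseteq X}|\{x:(x,H)\in R\}|$. **From networks to index coding.** Let $\mathbb N$ be a network given by a finite acyclic directed graph with edge set $E$ and a message set $X$, where each message $x$ is available on its own input edge $s_x$ (the input edges are those whose tail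 has in-degree $0$) and each output edge $e$ (an edge whose head has out-degree $0$) demands a message $\delta(e)$, with $\delta$ onto $X$. The index instance $\mathcal I_{\mathbb N}$ has the messages $X\cup\{y_e:e\in E\}$ and the clients $(x,\{y_{s_x}\})$ and $(y_{s_x},\{x\})$ for $x\in X$; $(y_e,\{y_{e'}: e' \text{ a parent edge of } e\})$ for each $e\in E$ that is not an input edge; $(\delta(e),\{y_e\})$ for each output edge $e$; and $(y_e,X)$ for each $e\in E$. **The network $\mathcal N_3$** (of Dougherty, Freiling and Zeger). It has messages $a,b,c,d,e$, each carried by an input edge into a node that holds it. It has $12$ bottleneck edges and $10$ terminals. Each of these has incoming edges from exactly the sources listed (a message stands for the node that holds it; a bottleneck edge stands for its head), and each terminal has one output edge, which demands the message shown: * (Fano network on $a,b,c$) $w$ from $a,b$; $y$ from $b,c$; $x$ from $a,y$; $z$ from $w,y$; terminals: $c$ from $w,x$; $b$ from $x,z$; $a$ from $z,c$. * (non-Fano network on $a,b,c$) $w_1$ from $a,b,c$; $x_1$ from $a,b$; $y_1$ from $a,c$; $z_1$ from $b,c$; terminals: $c$ from $w_1,x_1$; $b$ from $w_1,y_1$;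 $a$ from $w_1,z_1$. * (non-Fano network on $c,d,e$) $w_2$ from $c,d,e$; $x_2$ from $d,e$; $y_2$ from $c,d$; $z_2$ from $c,e$; terminals: $c$ from $w_2,x_2$; $e$ from $w_2,y_2$; $d$ from $w_2,z_2$. * a last terminal: $c$ from $x_1,y_1,z_1,x_2,y_2,z_2$. **Corollary.** For the instance $\mathcal I_{\mathcal N_3}$, $$\lambda(2,4)=\mu(\mathcal I_{\mathcal N_3}),$$ and for every positive integer $n$ and every prime power $q$ (every finite field $\mathbb F_q$), $$\lambda^*(n,q)>\lambda(2,4)=\mu(\mathcal I_{\mathcal N_3}).$$ -/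

import Mathlib

noncomputable section

/-! ### The Index Coding problem -/

/-- An instance of the Index Coding problem with message set `X`: a set of clients `(x, H)`, where
`x` is the message that the client wants and `H ⊆ X \ {x}` is the set of messages that it has. -/
structure IndexInstance (X : Type*) where
  clients : Set (X × Set X)
  wants_notMem_has : ∀ r ∈ clients, r.1 ∉ r.2

namespace IndexInstance

variable {X : Type*} (I : IndexInstance X)

/-- `f` is an index code: every message is a vector of `n` packets from the alphabet `A`, and `ℓ`
packets are broadcast. Every client recovers the message it wants from the broadcast and from the
messages it has. -/
def IsCode (n : ℕ) (A : Type*) (ℓ : ℕ) (f : (X → Fin n → A) → (Fin ℓ → A)) : Prop :=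
  ∀ r ∈ I.clients, ∃ ψ : (Fin ℓ → A) → (r.2 → Fin n → A) → (Fin n → A),
    ∀ x : X → Fin n → A, ψ (f x) (fun i => x i) = x r.1

/-- `f` is a linear index code over the field `F`: the encoding function and all decoding functions
are linear over `F` in the packets. -/
def IsLinearCode (n : ℕ) (F : Type*) [Field F] (ℓ : ℕ)
    (f : (X → Fin n → F) →ₗ[F] (Fin ℓ → F)) : Prop :=
  ∀ r ∈ I.clients, ∃ ψ : ((Fin ℓ → F) × (r.2 → Fin n → F)) →ₗ[F] (Fin n → F),
    ∀ x : X → Fin n → F, ψ (f x, fun i => x i) = x r.1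

/-- `ℓ(n, q)`: the smallest number of packets that an index code of block length `n` over the
alphabet `{0, …, q - 1}` has to broadcast. -/
def length (n q : ℕ) : ℕ :=
  sInf {ℓ : ℕ | ∃ f : (X → Fin n → Fin q) → (Fin ℓ → Fin q), I.IsCode n (Fin q) ℓ f}

/-- The smallest number of packets that a linear index code of block length `n` over the field `F`
has to broadcast. -/
def linearLength (n : ℕ) (F : Type*) [Field F] : ℕ :=
  sInf {ℓ : ℕ | ∃ f : (X → Fin n → F) →ₗ[F] (Fin ℓ → F), I.IsLinearCode n F ℓ f}

/-- The optimal rate `λ(n, q) = ℓ(n, q) / n`. -/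
def rate (n q : ℕ) : ℚ := (I.length n q : ℚ) / n

/-- The optimal rate `λ*(n, q)` of a vector linear code of block length `n` over the field `F`
with `q` elements. -/
def linearRate (n : ℕ) (F : Type*) [Field F] : ℚ := (I.linearLength n F : ℚ) / n

/-- `μ(I)`: the largest number of messages wanted by a collection of clients that all have the same
set of messages. -/
def mu : ℕ := ⨆ H : Set X, {x : X | (x, H) ∈ I.clients}.ncard

/-- The supremum in `mu` is a maximum over a bounded family when there are finitely many
messages. -/
theorem bddAbove_mu [Finite X] :
    BddAbove (Set.range fun H : Set X => {x : X | (x, H) ∈ I.clients}.ncard) := by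
  refine ⟨Nat.card X, ?_⟩
  rintro _ ⟨H, rfl⟩
  simpa [Set.ncard_univ] using
    Set.ncard_le_ncard (Set.subset_univ {x : X | (x, H) ∈ I.clients}) Set.finite_univ

/-- Broadcasting all packets is a linear code, so the minimum in `linearLength` is attained. -/
theorem exists_linearCode [Finite X] (n : ℕ) (F : Type*) [Field F] :
    ∃ (ℓ : ℕ) (f : (X → Fin n → F) →ₗ[F] (Fin ℓ → F)), I.IsLinearCode n F ℓ f := by
  have := Fintype.ofFinite X
  let e := Fintype.equivFin (X × Fin n)
  let f : (X → Fin n → F) →ₗ[F] (Fin (Fintype.card (X × Fin n)) → F) :=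
    { toFun := fun x j => x (e.symm j).1 (e.symm j).2
      map_add' := fun _ _ => rfl
      map_smul' := fun _ _ => rfl }
  refine ⟨_, f, fun r _ => ?_⟩
  exact ⟨(LinearMap.pi fun i => LinearMap.proj (e (r.1, i))).comp (LinearMap.fst F _ _),
    fun x => by ext i; simp [f]⟩

/-- Broadcasting all packets is a code, so the minimum in `length` is attained. -/
theorem exists_code [Finite X] (n : ℕ) (A : Type*) :
    ∃ (ℓ : ℕ) (f : (X → Fin n → A) → (Fin ℓ → A)), I.IsCode n A ℓ f := by
  have := Fintype.ofFinite X
  let e := Fintype.equivFin (X × Fin n)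
  refine ⟨_, fun x j => x (e.symm j).1 (e.symm j).2, fun r _ => ?_⟩
  exact ⟨fun s _ i => s (e (r.1, i)), fun x => by ext i; simp⟩

end IndexInstance

/-! ### Communication networks and their index instances -/

/-- A communication network with nodes `V`, edges `E` and messages `X`: an acyclic directed graph,
whose input edges (those with a tail of in-degree zero) correspond to the messages, and each of
whose output edges (those with a head of out-degree zero) demands a message, such that every
message is demanded. -/
structure CodingNetwork (V E X : Type*) where
  tail : E → V
  head : E → V
  acyclic : ∀ v, ¬ Relation.TransGen (fun u w => ∃ e, tail e = u ∧ head e = w) v v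
  /-- The input edge at whose tail the message is available. -/
  inputEdge : X ≃ {e : E // ∀ e', head e' ≠ tail e}
  /-- The message demanded at the head of the output edge. -/
  demand : {e : E // ∀ e', tail e' ≠ head e} → X
  demand_surjective : Function.Surjective demand

namespace CodingNetwork

variable {V E X : Type*} (N : CodingNetwork V E X)

def IsInput (e : E) : Prop := ∀ e', N.head e' ≠ N.tail e

def IsOutput (e : E) : Prop := ∀ e', N.tail e' ≠ N.head e

/-- The parent edges of `e`. -/
def parents (e : E) : Set E := {e' | N.head e' = N.tail e}

theorem notMem_parents (e : E) : e ∉ N.parents e := fun h =>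
  N.acyclic (N.tail e) (.single ⟨e, rfl, h⟩)

/-- The index instance of the network. Its messages are the messages `x` of the network, here
`Sum.inl x`, and one message `y` for each edge `e`, here `Sum.inr e`. -/
def indexInstance : IndexInstance (X ⊕ E) where
  clients :=
    {r | ∃ x : X, r = (.inl x, {.inr (N.inputEdge x).1})} ∪
    {r | ∃ x : X, r = (.inr (N.inputEdge x).1, {.inl x})} ∪
    {r | ∃ e : E, ¬ N.IsInput e ∧ r = (.inr e, Sum.inr '' N.parents e)} ∪
    {r | ∃ (e : E) (he : N.IsOutput e), r = (.inl (N.demand ⟨e, he⟩), {.inr e})} ∪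
    {r | ∃ e : E, r = (.inr e, Set.range Sum.inl)}
  wants_notMem_has := by
    rintro r ((((⟨x, rfl⟩ | ⟨x, rfl⟩) | ⟨e, -, rfl⟩) | ⟨e, he, rfl⟩) | ⟨e, rfl⟩)
    · simp
    · simp
    · simpa using N.notMem_parents e
    · simp
    · simp

end CodingNetwork

/-! ### The Dougherty–Freiling–Zeger network

It has five messages `a, b, c, d, e`. It joins, at the nodes that hold the messages, one copy of the
Fano network on `a, b, c` and two copies of the non-Fano network, one on `a, b, c` and one on
`c, d, e`; the last terminals of the two copies of the non-Fano network, which demand `c`, are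
merged into one. -/

namespace DFZ

/-- The messages. -/
inductive Msg
  | a | b | c | d | e
  deriving DecidableEq

instance : Fintype Msg where
  elems := {.a, .b, .c, .d, .e}
  complete x := by cases x <;> decide

/-- The bottleneck edges. -/
inductive Link
  | fanoW | fanoY | fanoX | fanoZ
  | leftW | leftX | leftY | leftZ
  | rightW | rightX | rightY | rightZ
  deriving DecidableEq

instance : Fintype Link where
  elems := {.fanoW, .fanoY, .fanoX, .fanoZ, .leftW, .leftX, .leftY, .leftZ,
    .rightW, .rightX, .rightY, .rightZ}
  complete x := by cases x <;> decide

/-- The terminals. -/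
inductive Term
  | fanoC | fanoB | fanoA
  | leftC | leftB | leftA
  | rightC | rightE | rightD
  | lastC
  deriving DecidableEq

instance : Fintype Term where
  elems := {.fanoC, .fanoB, .fanoA, .leftC, .leftB, .leftA, .rightC, .rightE,
    .rightD, .lastC}
  complete x := by cases x <;> decide

/-- The nodes. `source m` is the tail of the input edge of the message `m`, and `hub m` its head.
The bottleneck edge `l` leads from `linkIn l` to `linkOut l`. An output edge leads from the node
`terminal t` to the node `sink t`. -/
inductive Node
  | source (m : Msg)
  | hub (m : Msg)
  | linkIn (l : Link)
  | linkOut (l : Link)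
  | terminal (t : Term)
  | sink (t : Term)
  deriving DecidableEq, Fintype

open Msg Link Term Node

/-- The messages that enter a bottleneck edge directly. -/
def linkMsgs : Link → Finset Msg
  | fanoW => {a, b}
  | fanoY => {b, c}
  | fanoX => {a}
  | fanoZ => ∅
  | leftW => {a, b, c}
  | leftX => {a, b}
  | leftY => {a, c}
  | leftZ => {b, c}
  | rightW => {c, d, e}
  | rightX => {d, e}
  | rightY => {c, d}
  | rightZ => {c, e}

/-- The bottleneck edges that feed a bottleneck edge. -/
def linkLinks : Link → Finset Link
  | fanoX => {fanoY}
  | fanoZ => {fanoW, fanoY}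
  | _ => ∅

/-- The messages that enter a terminal directly. -/
def termMsgs : Term → Finset Msg
  | fanoA => {c}
  | _ => ∅

/-- The bottleneck edges that feed a terminal. -/
def termLinks : Term → Finset Link
  | fanoC => {fanoW, fanoX}
  | fanoB => {fanoX, fanoZ}
  | fanoA => {fanoZ}
  | leftC => {leftW, leftX}
  | leftB => {leftW, leftY}
  | leftA => {leftW, leftZ}
  | rightC => {rightW, rightX}
  | rightE => {rightW, rightY}
  | rightD => {rightW, rightZ}
  | lastC => {leftX, leftY, leftZ, rightX, rightY, rightZ}

/-- The message demanded at a terminal. -/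
def termDemand : Term → Msg
  | fanoC => c
  | fanoB => b
  | fanoA => a
  | leftC => c
  | leftB => b
  | leftA => a
  | rightC => c
  | rightE => e
  | rightD => d
  | lastC => c

/-- There is an edge from the first node to the second. -/
def Adj : Node → Node → Prop
  | source m, hub m' => m = m'
  | hub m, linkIn l => m ∈ linkMsgs l
  | hub m, terminal t => m ∈ termMsgs t
  | linkIn l, linkOut l' => l = l'
  | linkOut l, linkIn l' => l ∈ linkLinks l'
  | linkOut l, terminal t => l ∈ termLinks t
  | terminal t, sink t' => t = t'
  | _, _ => False

/-- The edges. -/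
abbrev Edge : Type := {p : Node × Node // Adj p.1 p.2}

/-- A height function that shows the graph to be acyclic. -/
def height : Node → ℕ
  | source _ => 0
  | hub _ => 1
  | linkIn l => if linkLinks l = ∅ then 2 else 4
  | linkOut l => if linkLinks l = ∅ then 3 else 5
  | terminal _ => 6
  | sink _ => 7

theorem height_lt {u v : Node} (h : Adj u v) : height u < height v := by
  rcases u with m | m | l | l | t | t <;> rcases v with m' | m' | l' | l' | t' | t' <;>
    simp only [Adj] at h
  · simp [height]
  · simp only [height]; split_ifs <;> omega
  · simp [height]
  · subst h; simp only [height]; split_ifs <;> omega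
  · cases l' <;> simp [linkLinks] at h <;> rcases h with rfl | rfl <;> decide
  · simp only [height]; split_ifs <;> omega
  · simp [height]

theorem isInput_iff (p : Edge) :
    (∀ p' : Edge, p'.1.2 ≠ p.1.1) ↔ ∃ m, p.1 = (source m, hub m) := by
  obtain ⟨⟨u, v⟩, h⟩ := p
  constructor
  · intro hp
    rcases u with m | m | l | l | t | t
    · cases v <;> simp only [Adj] at h
      subst h; exact ⟨m, rfl⟩
    · exact absurd rfl (hp ⟨(source m, hub m), rfl⟩)
    · exfalso
      cases l
      case fanoZ => exact hp ⟨(linkOut fanoW, linkIn fanoZ), by simp [Adj, linkLinks]⟩ rfl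
      case leftZ => exact hp ⟨(hub b, linkIn leftZ), by simp [Adj, linkMsgs]⟩ rfl
      case fanoY => exact hp ⟨(hub b, linkIn fanoY), by simp [Adj, linkMsgs]⟩ rfl
      case rightW => exact hp ⟨(hub c, linkIn rightW), by simp [Adj, linkMsgs]⟩ rfl
      case rightX => exact hp ⟨(hub d, linkIn rightX), by simp [Adj, linkMsgs]⟩ rfl
      case rightY => exact hp ⟨(hub c, linkIn rightY), by simp [Adj, linkMsgs]⟩ rfl
      case rightZ => exact hp ⟨(hub c, linkIn rightZ), by simp [Adj, linkMsgs]⟩ rfl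
      all_goals exact hp ⟨(hub a, linkIn _), by simp [Adj, linkMsgs]⟩ rfl
    · exact absurd rfl (hp ⟨(linkIn l, linkOut l), rfl⟩)
    · exfalso
      have : ∃ l, l ∈ termLinks t := by cases t <;> simp [termLinks]
      obtain ⟨l, hl⟩ := this
      exact hp ⟨(linkOut l, terminal t), hl⟩ rfl
    · cases v <;> simp only [Adj] at h
  · rintro ⟨m, hm⟩ ⟨⟨u', v'⟩, h'⟩ rfl
    simp only [Prod.mk.injEq] at hm
    obtain ⟨rfl, rfl⟩ := hm
    cases u' <;> simp only [Adj] at h'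

theorem isOutput_iff (p : Edge) :
    (∀ p' : Edge, p'.1.1 ≠ p.1.2) ↔ ∃ t, p.1 = (terminal t, sink t) := by
  obtain ⟨⟨u, v⟩, h⟩ := p
  constructor
  · intro hp
    rcases v with m | m | l | l | t | t
    · cases u <;> simp only [Adj] at h
    · exfalso
      have : ∃ l, m ∈ linkMsgs l := by
        cases m
        · exact ⟨fanoW, by simp [linkMsgs]⟩
        · exact ⟨fanoW, by simp [linkMsgs]⟩
        · exact ⟨fanoY, by simp [linkMsgs]⟩
        · exact ⟨rightW, by simp [linkMsgs]⟩
        · exact ⟨rightW, by simp [linkMsgs]⟩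
      obtain ⟨l, hl⟩ := this
      exact hp ⟨(hub m, linkIn l), hl⟩ rfl
    · exact absurd rfl (hp ⟨(linkIn l, linkOut l), rfl⟩)
    · exfalso
      have : (∃ l', l ∈ linkLinks l') ∨ ∃ t, l ∈ termLinks t := by
        clear hp h
        revert l; decide
      rcases this with ⟨l', hl⟩ | ⟨t, ht⟩
      · exact hp ⟨(linkOut l, linkIn l'), hl⟩ rfl
      · exact hp ⟨(linkOut l, terminal t), ht⟩ rfl
    · exact absurd rfl (hp ⟨(terminal t, sink t), rfl⟩)
    · cases u <;> simp only [Adj] at h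
      subst h; exact ⟨_, rfl⟩
  · rintro ⟨t, ht⟩ ⟨⟨u', v'⟩, h'⟩ rfl
    simp only [Prod.mk.injEq] at ht
    obtain ⟨rfl, rfl⟩ := ht
    cases v' <;> simp only [Adj] at h'

/-- The message demanded on an edge into a sink; only its values on the output edges are used. -/
def nodeDemand : Node → Msg
  | sink t => termDemand t
  | _ => c

/-- The Dougherty–Freiling–Zeger network. -/
def network : CodingNetwork Node Edge Msg where
  tail p := p.1.1
  head p := p.1.2
  acyclic v h := by
    have key : ∀ u w, Relation.TransGen (fun u w => ∃ p : Edge, p.1.1 = u ∧ p.1.2 = w) u w →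
        height u < height w := by
      intro u w h
      induction h with
      | single h => obtain ⟨p, rfl, rfl⟩ := h; exact height_lt p.2
      | tail _ h ih => obtain ⟨p, rfl, rfl⟩ := h; exact ih.trans (height_lt p.2)
    exact lt_irrefl _ (key v v h)
  inputEdge := Equiv.ofBijective
    (fun m => ⟨⟨(source m, hub m), rfl⟩, (isInput_iff _).2 ⟨m, rfl⟩⟩) (by
      constructor
      · intro m m' h
        simpa [Subtype.ext_iff] using h
      · rintro ⟨p, hp⟩
        obtain ⟨m, hm⟩ := (isInput_iff p).1 hp
        exact ⟨m, Subtype.ext (Subtype.ext hm.symm)⟩)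
  demand p := nodeDemand p.1.1.2
  demand_surjective m := by
    have : ∃ t, termDemand t = m := by revert m; decide
    obtain ⟨t, ht⟩ := this
    exact ⟨⟨⟨(terminal t, sink t), rfl⟩, (isOutput_iff _).2 ⟨t, rfl⟩⟩, ht⟩

end DFZ

end

/-! ### Index codes and the lower bound by `mu` -/

namespace IndexInstance

variable {X : Type*} (I : IndexInstance X)

/-! Everything is compared with the number of edges of the network. The clients that have all
network messages and want one edge message each give `Nat.card E ≤ mu`, and counting broadcasts
gives `n * mu ≤ ℓ` for every code. A network code over four symbols becomes an index code of length
`n * Nat.card E` (`IsNetworkCode.length_le`), so for this network both bounds are tight.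

Conversely, a linear index code of length at most `n * Nat.card E` is bijective on the edge
messages; solving for them where the broadcast is zero yields a linear network code
(`exists_linear_networkCode`). None exists here. The Fano part forces characteristic two. There,
each non-Fano part can carry zero on its three two-input bottlenecks whatever the value of `c`, so
the last terminal cannot recover `c`.

The nonlinear code escapes this by using XOR on the Fano part and addition modulo four on the
others. The non-Fano parts then reveal `2c` and twice the bit-swapped `c`, one bit of `c` each. -/

theorem isCode_of_forall_eq {n : ℕ} {A : Type*} [Nonempty A] {ℓ : ℕ}
    {f : (X → Fin n → A) → (Fin ℓ → A)}
    (h : ∀ r ∈ I.clients, ∀ u v : X → Fin n → A, f u = f v → (∀ i ∈ r.2, u i = v i) →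
      u r.1 = v r.1) : I.IsCode n A ℓ f := by
  classical
  intro r hr
  let g : (X → Fin n → A) → (Fin ℓ → A) × (r.2 → Fin n → A) := fun x => (f x, fun i => x i)
  have hg : (fun x : X → Fin n → A => x r.1).FactorsThrough g := by
    intro u v huv
    simp only [g, Prod.mk.injEq] at huv
    exact h r hr u v huv.1 fun i hi => congrFun huv.2 ⟨i, hi⟩
  -- Pairs outside the range of `g` never occur, so the decoder may take any value there.
  refine ⟨fun s t => Function.extend g (fun x => x r.1) (fun _ => Classical.arbitrary _) (s, t),
    fun x => ?_⟩
  exact hg.extend_apply _ x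

variable {I} in
theorem IsCode.eq_of_eq {n : ℕ} {A : Type*} {ℓ : ℕ} {f : (X → Fin n → A) → (Fin ℓ → A)}
    (hf : I.IsCode n A ℓ f) {r : X × Set X} (hr : r ∈ I.clients) {u v : X → Fin n → A}
    (huv : f u = f v) (h : ∀ i ∈ r.2, u i = v i) : u r.1 = v r.1 := by
  obtain ⟨ψ, hψ⟩ := hf r hr
  rw [← hψ u, ← hψ v, huv]
  congr 1
  funext i
  exact h i i.2

variable {I} in
theorem IsLinearCode.eq_zero {n : ℕ} {F : Type*} [Field F] {ℓ : ℕ}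
    {f : (X → Fin n → F) →ₗ[F] (Fin ℓ → F)} (hf : I.IsLinearCode n F ℓ f) {r : X × Set X}
    (hr : r ∈ I.clients) {u : X → Fin n → F} (hu : f u = 0) (h : ∀ i ∈ r.2, u i = 0) :
    u r.1 = 0 := by
  obtain ⟨ψ, hψ⟩ := hf r hr
  have h0 : (f u, fun i : r.2 => u i) = 0 := by
    rw [hu]
    ext1
    · rfl
    · funext i
      exact h i i.2
  rw [← hψ u, h0, map_zero]

variable {I} in
/-- The messages wanted by clients that have the same messages can all be recovered from the
broadcast once the remaining messages are fixed. -/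
theorem IsCode.mul_ncard_le [Finite X] {n q : ℕ} (hq : 2 ≤ q) {ℓ : ℕ}
    {f : (X → Fin n → Fin q) → (Fin ℓ → Fin q)} (hf : I.IsCode n (Fin q) ℓ f) (H : Set X) :
    n * {x : X | (x, H) ∈ I.clients}.ncard ≤ ℓ := by
  classical
  have := Fintype.ofFinite X
  have : NeZero q := ⟨by omega⟩
  set W : Set X := {x : X | (x, H) ∈ I.clients} with hW
  let ext : (W → Fin n → Fin q) → X → Fin n → Fin q := fun u x => if h : x ∈ W then u ⟨x, h⟩ else 0
  have hinj : Function.Injective fun u => f (ext u) := by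
    intro u v huv
    funext ⟨x, hx⟩
    have key := hf.eq_of_eq (r := (x, H)) hx huv fun i hi => by
      -- No client has the message it wants, so `H` misses `W` and both extensions are zero on `H`.
      have : i ∉ W := fun hiW => I.wants_notMem_has _ hiW hi
      simp [ext, this]
    simpa [ext, hx] using key
  have hcard := Fintype.card_le_of_injective _ hinj
  simp only [Fintype.card_pi, Fintype.card_fin, Finset.prod_const, Finset.card_univ] at hcard
  rw [← pow_mul] at hcard
  have := (Nat.pow_le_pow_iff_right (by omega)).1 hcard
  rwa [← Nat.card_eq_fintype_card] at this

theorem mul_mu_le_length [Finite X] {n q : ℕ} (hq : 2 ≤ q) : n * I.mu ≤ I.length n q := by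
  have hmem : I.length n q ∈ {ℓ : ℕ | ∃ f : (X → Fin n → Fin q) → (Fin ℓ → Fin q),
      I.IsCode n (Fin q) ℓ f} := Nat.sInf_mem (I.exists_code n (Fin q))
  obtain ⟨f, hf⟩ := hmem
  obtain ⟨H, hH⟩ := Nat.sSup_mem (Set.range_nonempty _) I.bddAbove_mu
  have := hf.mul_ncard_le hq H
  rw [mu, iSup, ← hH]
  exact this

end IndexInstance

/-! ### Network codes and index codes -/

namespace CodingNetwork

variable {V E X : Type*} (N : CodingNetwork V E X)

theorem card_le_mu [Finite X] [Finite E] : Nat.card E ≤ N.indexInstance.mu := by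
  refine le_trans ?_ (le_ciSup N.indexInstance.bddAbove_mu (Set.range Sum.inl))
  rw [← Set.ncard_univ, ← Set.ncard_image_of_injective _ (Sum.inr_injective (α := X))]
  refine Set.ncard_le_ncard ?_ (Set.toFinite _)
  rintro _ ⟨e, -, rfl⟩
  exact Or.inr ⟨e, rfl⟩

/-- `φ` is a network code over `A`: `φ x e` is the symbol on the edge `e` when the messages are
`x`. The symbol on an edge is determined by those on its parents. -/
structure IsNetworkCode {A : Type*} (φ : (X → A) → E → A) : Prop where
  input : ∀ m x, φ x (N.inputEdge m).1 = x m
  edge : ∀ e, ¬ N.IsInput e → ∀ x x', (∀ p ∈ N.parents e, φ x p = φ x' p) → φ x e = φ x' e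
  output : ∀ e (he : N.IsOutput e) x, φ x e = x (N.demand ⟨e, he⟩)

variable {N} in
/-- Masking the message of every edge with the symbol on that edge turns a network code into an
index code. -/
theorem IsNetworkCode.length_le [Finite E] {q : ℕ} [NeZero q] {φ : (X → Fin q) → E → Fin q}
    (hφ : N.IsNetworkCode φ) (n : ℕ) : N.indexInstance.length n q ≤ n * Nat.card E := by
  have := Fintype.ofFinite E
  let k := Fintype.equivFin (E × Fin n)
  have hcard : Fintype.card (E × Fin n) = n * Nat.card E := by
    simp [Nat.card_eq_fintype_card, mul_comm]
  rw [← hcard]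
  -- The network code is applied to each of the `n` packet positions separately. Of the addition on
  -- `Fin q`, only cancellation matters.
  refine Nat.sInf_le ⟨fun v j => v (.inr (k.symm j).1) (k.symm j).2 +
    φ (fun m => v (.inl m) (k.symm j).2) (k.symm j).1, ?_⟩
  refine IndexInstance.isCode_of_forall_eq _ fun r hr u v huv => ?_
  have key : ∀ e i, u (.inr e) i + φ (fun m => u (.inl m) i) e =
      v (.inr e) i + φ (fun m => v (.inl m) i) e := fun e i => by
    simpa using congrFun huv (k (e, i))
  rcases hr with (((⟨m, rfl⟩ | ⟨m, rfl⟩) | ⟨e, he, rfl⟩) | ⟨e, he, rfl⟩) | ⟨e, rfl⟩ <;>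
    intro h <;> funext i
  · have := key (N.inputEdge m).1 i
    rw [h _ rfl, hφ.input, hφ.input] at this
    exact add_left_cancel this
  · have := key (N.inputEdge m).1 i
    rw [hφ.input, hφ.input, h _ rfl] at this
    exact add_right_cancel this
  · have := key e i
    rw [hφ.edge e he _ (fun m => v (.inl m) i) fun p hp => ?_] at this
    · exact add_right_cancel this
    · have := key p i
      rw [h _ ⟨p, hp, rfl⟩] at this
      exact add_left_cancel this
  · have := key e i
    rw [h _ rfl, hφ.output e he, hφ.output e he] at this
    exact add_left_cancel this
  · have := key e i
    have hx : ∀ m, u (.inl m) = v (.inl m) := fun m => h _ ⟨m, rfl⟩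
    simp only [hx] at this
    exact add_right_cancel this

/-- A linear index code whose length is at most the number of edges times the block length comes
from a linear network code. -/
theorem exists_linear_networkCode [Finite E] {n ℓ : ℕ} {F : Type*} [Field F]
    {f : (X ⊕ E → Fin n → F) →ₗ[F] (Fin ℓ → F)} (hf : N.indexInstance.IsLinearCode n F ℓ f)
    (hℓ : ℓ ≤ n * Nat.card E) :
    ∃ φ : (X → Fin n → F) →ₗ[F] (E → Fin n → F),
      (∀ m x, x m = 0 → φ x (N.inputEdge m).1 = 0) ∧
      (∀ e, ¬ N.IsInput e → ∀ x, (∀ p ∈ N.parents e, φ x p = 0) → φ x e = 0) ∧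
      ∀ e (he : N.IsOutput e) x, φ x e = 0 → x (N.demand ⟨e, he⟩) = 0 := by
  have := Fintype.ofFinite E
  let s := (LinearEquiv.sumArrowLequivProdArrow X E F (Fin n → F)).symm
  let g := f ∘ₗ s.toLinearMap
  let B := g ∘ₗ LinearMap.inr F (X → Fin n → F) (E → Fin n → F)
  let C := g ∘ₗ LinearMap.inl F (X → Fin n → F) (E → Fin n → F)
  -- With all network messages zero, a zero broadcast forces every edge message to be zero, by the
  -- clients that have exactly the network messages.
  have hB : Function.Injective B := by
    rw [injective_iff_map_eq_zero]
    intro y hy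
    funext e
    refine hf.eq_zero (r := (.inr e, Set.range Sum.inl)) (u := s (0, y)) (.inr ⟨e, rfl⟩) hy ?_
    rintro _ ⟨m, rfl⟩
    rfl
  have hle := LinearMap.finrank_le_finrank_of_injective hB
  have heq : Module.finrank F (E → Fin n → F) = Module.finrank F (Fin ℓ → F) := by
    refine le_antisymm hle ?_
    simpa [Module.finrank_pi_fintype, mul_comm, Nat.card_eq_fintype_card] using hℓ
  let Be := LinearEquiv.ofInjectiveOfFinrankEq B hB heq
  -- The graph of `φ` is the kernel of the broadcast. On it the clients must decode from their side
  -- information alone, which is what a network code requires.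
  let φ := -(Be.symm.toLinearMap ∘ₗ C)
  have hφ : ∀ x, f (s (x, φ x)) = 0 := fun x => by
    have h1 : B (φ x) = - C x := by
      have : Be (φ x) = - C x := by simp [φ]
      exact this
    have h2 : f (s (x, φ x)) = C x + B (φ x) := by
      change g _ = g _ + g _
      rw [← map_add]
      simp
    rw [h2, h1, add_neg_cancel]
  refine ⟨φ, fun m x hx => ?_, fun e he x hx => ?_, fun e he x hx => ?_⟩
  · refine hf.eq_zero (r := (.inr (N.inputEdge m).1, {.inl m}))
      (.inl (.inl (.inl (.inr ⟨m, rfl⟩)))) (hφ x) ?_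
    rintro _ rfl
    exact hx
  · refine hf.eq_zero (r := (.inr e, Sum.inr '' N.parents e))
      (.inl (.inl (.inr ⟨e, he, rfl⟩))) (hφ x) ?_
    rintro _ ⟨p, hp, rfl⟩
    exact hx p hp
  · refine hf.eq_zero (r := (.inl (N.demand ⟨e, he⟩), {.inr e}))
      (.inl (.inr ⟨e, he, rfl⟩)) (hφ x) ?_
    rintro _ rfl
    exact hx

end CodingNetwork

namespace DFZ

open Msg Link Term Node

instance : Finite Edge := inferInstanceAs (Finite {p : Node × Node // Adj p.1 p.2})

/-! ### A code over an alphabet of size four -/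

/-- The transposition of `1` and `2`; it exchanges the two bits of an element of `{0, 1, 2, 3}`. -/
def swapBits (i : Fin 4) : Fin 4 := Equiv.swap 1 2 i

/-- The symbols on the bottleneck edges: the Fano network adds bitwise, the non-Fano networks add
modulo four, one of them after exchanging the two bits. -/
def linkSymbol (v : Msg → Fin 4) : Link → Fin 4
  | fanoW => v a ^^^ v b
  | fanoY => v b ^^^ v c
  | fanoX => v a ^^^ (v b ^^^ v c)
  | fanoZ => (v a ^^^ v b) ^^^ (v b ^^^ v c)
  | leftW => v a + v b + v c
  | leftX => v a + v b
  | leftY => v a + v c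
  | leftZ => v b + v c
  | rightW => swapBits (v c) + v d + v e
  | rightX => v d + v e
  | rightY => swapBits (v c) + v d
  | rightZ => swapBits (v c) + v e

/-- The symbol on the edges that leave a node. -/
def nodeSymbol (v : Msg → Fin 4) : Node → Fin 4
  | source m => v m
  | hub m => v m
  | linkIn l => linkSymbol v l
  | linkOut l => linkSymbol v l
  | terminal t => v (termDemand t)
  | sink _ => 0

theorem linkSymbol_congr (l : Link) (u v : Msg → Fin 4) (hm : ∀ m ∈ linkMsgs l, u m = v m)
    (hl : ∀ l' ∈ linkLinks l, linkSymbol u l' = linkSymbol v l') :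
    linkSymbol u l = linkSymbol v l := by
  cases l <;> simp_all [linkMsgs, linkLinks, linkSymbol]

theorem swapBits_injective : Function.Injective swapBits := (Equiv.swap 1 2).injective

/-- Doubling modulo four retains exactly the low bit; after the swap it retains the high bit. -/
theorem eq_of_double_eq : ∀ i j : Fin 4, i + i = j + j →
    swapBits i + swapBits i = swapBits j + swapBits j → i = j := by
  unfold swapBits
  decide

theorem xor_decode_fst : ∀ i j k : Fin 4, (i ^^^ j) ^^^ (i ^^^ (j ^^^ k)) = k := by decide

theorem xor_decode_snd : ∀ i j k : Fin 4,
    (i ^^^ (j ^^^ k)) ^^^ ((i ^^^ j) ^^^ (j ^^^ k)) = j := by decide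

theorem xor_decode_trd : ∀ i j k : Fin 4, ((i ^^^ j) ^^^ (j ^^^ k)) ^^^ k = i := by decide

open Fin.CommRing in
-- Fano terminals cancel by XOR; the other terminals with two inputs subtract modulo four.
theorem termDemand_congr (t : Term) (u v : Msg → Fin 4) (hm : ∀ m ∈ termMsgs t, u m = v m)
    (hl : ∀ l ∈ termLinks t, linkSymbol u l = linkSymbol v l) :
    u (termDemand t) = v (termDemand t) := by
  cases t <;> simp only [termMsgs, termLinks, Finset.mem_insert, Finset.mem_singleton,
    forall_eq_or_imp, forall_eq, linkSymbol, termDemand] at hm hl ⊢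
  · rw [← xor_decode_fst (u a) (u b) (u c), hl.1, hl.2, xor_decode_fst]
  · rw [← xor_decode_snd (u a) (u b) (u c), hl.1, hl.2, xor_decode_snd]
  · rw [← xor_decode_trd (u a) (u b) (u c), hl, hm, xor_decode_trd]
  · linear_combination hl.1 - hl.2
  · linear_combination hl.1 - hl.2
  · linear_combination hl.1 - hl.2
  · exact swapBits_injective (by linear_combination hl.1 - hl.2)
  · linear_combination hl.1 - hl.2
  · linear_combination hl.1 - hl.2
  · obtain ⟨h1, h2, h3, h4, h5, h6⟩ := hl
    -- `(a + c) + (b + c) - (a + b) = 2c`, and likewise with the swapped `c` on the right-hand copy.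
    exact eq_of_double_eq _ _ (by linear_combination h2 + h3 - h1)
      (by linear_combination h5 + h6 - h4)

theorem not_isInput_iff (p : Edge) : ¬ network.IsInput p ↔ ¬ ∃ m, p.1 = (source m, hub m) :=
  not_congr (isInput_iff p)

theorem isNetworkCode :
    network.IsNetworkCode fun (v : Msg → Fin 4) (p : Edge) => nodeSymbol v p.1.1 where
  input _ _ := rfl
  edge := by
    rintro ⟨⟨s, t⟩, hp⟩ he u v h
    rw [not_isInput_iff] at he
    have h' : ∀ s' (hs : Adj s' s), nodeSymbol u s' = nodeSymbol v s' :=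
      fun s' hs => h ⟨(s', s), hs⟩ rfl
    change nodeSymbol u s = nodeSymbol v s
    rcases s with m | m | l | l | t' | t'
    · cases t <;> simp only [Adj] at hp
      subst hp
      exact absurd ⟨m, rfl⟩ he
    · exact h' (source m) rfl
    · exact linkSymbol_congr l u v (fun m hm => h' (hub m) hm) fun l' hl => h' (linkOut l') hl
    · exact h' (linkIn l) rfl
    · exact termDemand_congr t' u v (fun m hm => h' (hub m) hm) fun l hl => h' (linkOut l) hl
    · rfl
  output p hp v := by
    obtain ⟨t, ht⟩ := (isOutput_iff p).1 hp
    obtain ⟨⟨s, s'⟩, hs⟩ := p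
    simp only [Prod.mk.injEq] at ht
    obtain ⟨rfl, rfl⟩ := ht
    rfl

/-! ### Linear codes -/

section Linear

variable {F : Type*} [Field F] {V : Type*} [AddCommGroup V] [Module F V]

/-- Three messages are combined by the injective maps `α`, `β`, `γ`, and the combination together with
`δ p + ε q` determines the third message. Then `δ p + ε q` depends on `α p + β q` only. -/
theorem map_add_eq_zero_of_decode [FiniteDimensional F V] {α β γ δ ε : V →ₗ[F] V}
    (hα : Function.Injective α) (hγ : Function.Injective γ)
    (h : ∀ p q r, α p + β q + γ r = 0 → δ p + ε q = 0 → r = 0) {p q : V}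
    (hpq : α p + β q = 0) : δ p + ε q = 0 := by
  have hγs := LinearMap.injective_iff_surjective.1 hγ
  have hδ : Function.Injective δ := by
    rw [injective_iff_map_eq_zero]
    intro p hp
    obtain ⟨r, hr⟩ := hγs (-α p)
    have hr0 := h p 0 r (by simp [hr]) (by simp [hp])
    apply hα
    rw [map_zero, ← neg_eq_zero, ← hr, hr0, map_zero]
  -- `p'` makes the second combination vanish. Decoding shows that it makes `α p' + β q` vanish too,
  -- so injectivity of `α` gives `p' = p`.
  obtain ⟨p', hp'⟩ := LinearMap.injective_iff_surjective.1 hδ (-ε q)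
  obtain ⟨r, hr⟩ := hγs (-(α p' + β q))
  have hr0 := h p' q r (by rw [hr, add_neg_cancel]) (by rw [hp', neg_add_cancel])
  have h1 : α p' + β q = 0 := by rw [← neg_eq_zero, ← hr, hr0, map_zero]
  have : p = p' := hα (add_right_cancel (hpq.trans h1.symm))
  rw [this, hp', neg_add_cancel]

/-- The non-Fano network in characteristic two: for every value of `r` there are values of `p`, `q`
for which the three bottleneck edges with two inputs carry zero. -/
theorem exists_nonFano_eq_zero [FiniteDimensional F V] (h2 : (2 : F) = 0)
    {w x y z : V × V × V →ₗ[F] V}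
    (hx : ∀ r, x (0, 0, r) = 0) (hy : ∀ q, y (0, q, 0) = 0) (hz : ∀ p, z (p, 0, 0) = 0)
    (hr : ∀ v, w v = 0 → x v = 0 → v.2.2 = 0) (hq : ∀ v, w v = 0 → y v = 0 → v.2.1 = 0)
    (hp : ∀ v, w v = 0 → z v = 0 → v.1 = 0) (r : V) :
    ∃ p q, x (p, q, r) = 0 ∧ y (p, q, r) = 0 ∧ z (p, q, r) = 0 := by
  let i₁ : V →ₗ[F] V × V × V := LinearMap.inl F V (V × V)
  let i₂ : V →ₗ[F] V × V × V := LinearMap.inr F V (V × V) ∘ₗ LinearMap.inl F V V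
  let i₃ : V →ₗ[F] V × V × V := LinearMap.inr F V (V × V) ∘ₗ LinearMap.inr F V V
  have split (f : V × V × V →ₗ[F] V) (p q r) :
      f (p, q, r) = (f ∘ₗ i₁) p + (f ∘ₗ i₂) q + (f ∘ₗ i₃) r := by
    simp only [LinearMap.comp_apply, ← map_add]
    simp [i₁, i₂, i₃]
  have hx' (p q r) : x (p, q, r) = (x ∘ₗ i₁) p + (x ∘ₗ i₂) q := by
    rw [split, add_eq_left]
    exact hx r
  have hy' (p q r) : y (p, q, r) = (y ∘ₗ i₁) p + (y ∘ₗ i₃) r := by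
    rw [split, add_right_comm, add_eq_left]
    exact hy q
  have hz' (p q r) : z (p, q, r) = (z ∘ₗ i₂) q + (z ∘ₗ i₃) r := by
    rw [split, add_assoc, add_eq_right]
    exact hz p
  have h₁ : Function.Injective (w ∘ₗ i₁) :=
    (injective_iff_map_eq_zero _).2 fun p h => hp (p, 0, 0) h (hz p)
  have h₂ : Function.Injective (w ∘ₗ i₂) :=
    (injective_iff_map_eq_zero _).2 fun q h => hq (0, q, 0) h (hy q)
  have h₃ : Function.Injective (w ∘ₗ i₃) :=
    (injective_iff_map_eq_zero _).2 fun r h => hr (0, 0, r) h (hx r)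
  have hdouble (t : V) : t + t = 0 := by rw [← two_smul F, h2, zero_smul]
  -- All three messages are made to contribute the same vector to `w`. In characteristic two any two
  -- contributions cancel, which kills each two-input bottleneck.
  obtain ⟨p, hp₀⟩ := LinearMap.injective_iff_surjective.1 h₁ ((w ∘ₗ i₃) r)
  obtain ⟨q, hq₀⟩ := LinearMap.injective_iff_surjective.1 h₂ ((w ∘ₗ i₃) r)
  refine ⟨p, q, ?_, ?_, ?_⟩
  · rw [hx']
    refine map_add_eq_zero_of_decode h₁ h₃ (fun p q r h h' => hr (p, q, r) ?_ ?_)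
      (by rw [hp₀, hq₀, hdouble])
    · rw [split, h]
    · rw [hx', h']
  · rw [hy']
    refine map_add_eq_zero_of_decode h₁ h₂ (fun p r q h h' => hq (p, q, r) ?_ ?_)
      (by rw [hp₀, hdouble])
    · rw [split, add_right_comm, h]
    · rw [hy', h']
  · rw [hz']
    refine map_add_eq_zero_of_decode h₂ h₁ (fun q r p h h' => hp (p, q, r) ?_ ?_)
      (by rw [hq₀, hdouble])
    · rw [split, ← h]
      abel
    · rw [hz', h']

/-- The Fano network has no linear solution over a field of odd characteristic. -/
theorem two_smul_eq_zero_of_fano [FiniteDimensional F V] {w x y z : V × V × V →ₗ[F] V}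
    (hw : ∀ r, w (0, 0, r) = 0) (hy : ∀ p, y (p, 0, 0) = 0)
    (hx : ∀ v, v.1 = 0 → y v = 0 → x v = 0) (hz : ∀ v, w v = 0 → y v = 0 → z v = 0)
    (hr : ∀ v, w v = 0 → x v = 0 → v.2.2 = 0) (hq : ∀ v, x v = 0 → z v = 0 → v.2.1 = 0)
    (hp : ∀ v, z v = 0 → v.2.2 = 0 → v.1 = 0) (q : V) : (2 : F) • q = 0 := by
  let i₁ : V →ₗ[F] V × V × V := LinearMap.inl F V (V × V)
  let i₃ : V →ₗ[F] V × V × V := LinearMap.inr F V (V × V) ∘ₗ LinearMap.inr F V V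
  have surj {f : V →ₗ[F] V} (hf : ∀ v, f v = 0 → v = 0) : Function.Surjective f :=
    LinearMap.injective_iff_surjective.1 ((injective_iff_map_eq_zero f).2 hf)
  have hw₁ := surj (f := w ∘ₗ i₁) fun p h => hp (p, 0, 0) (hz _ h (hy p)) rfl
  have hz₁ := surj (f := z ∘ₗ i₁) fun p h => hp (p, 0, 0) h rfl
  have hy₃ := surj (f := y ∘ₗ i₃) fun r h => hr (0, 0, r) (hw r) (hx _ rfl h)
  have hx₃ := surj (f := x ∘ₗ i₃) fun r h => hr (0, 0, r) (hw r) h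
  have add₁ (f : V × V × V →ₗ[F] V) (p q r : V) : f (p, q, r) = f (p, 0, 0) + f (0, q, r) := by
    simp [← map_add]
  have add₃ (f : V × V × V →ₗ[F] V) (p q r : V) : f (p, q, r) = f (p, q, 0) + f (0, 0, r) := by
    simp [← map_add]
  -- `p` and `r` cancel the contribution of `q` to `w` and `y` respectively.
  obtain ⟨p, hp₀⟩ := hw₁ (-w (0, q, 0))
  obtain ⟨r, hr₀⟩ := hy₃ (-y (0, q, 0))
  change w (p, 0, 0) = _ at hp₀
  change y (0, 0, r) = _ at hr₀
  have hwpq (s) : w (p, q, s) = 0 := by rw [add₃, hw, add₁, hp₀]; simp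
  have hyqr (s) : y (s, q, r) = 0 := by rw [add₁, hy, add₃, hr₀]; simp
  -- Some third message `s` makes `x` vanish; as `w` already vanishes, the terminal decodes `s = 0`.
  have hxpq : x (p, q, 0) = 0 := by
    obtain ⟨s, hs⟩ := hx₃ (-x (p, q, 0))
    change x (0, 0, s) = _ at hs
    have hs0 : s = 0 := hr (p, q, s) (hwpq s) (by rw [add₃, hs, add_neg_cancel])
    rw [← neg_eq_zero, ← hs, hs0]
    exact map_zero x
  have hzq : z (0, q, 0) = 0 := by
    obtain ⟨s, hs⟩ := hz₁ (-z (0, q, 0))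
    change z (s, 0, 0) = _ at hs
    have hs0 : s = 0 := hp (s, q, 0) (by rw [add₁, hs, neg_add_cancel]) rfl
    rw [← neg_eq_zero, ← hs, hs0]
    exact map_zero z
  -- Two different splittings of this triple show that `x` and `z` both vanish on it, and from these
  -- the middle message is decoded.
  refine hq (p, (2 : F) • q, r) ?_ ?_
  · have : (p, (2 : F) • q, r) = (p, q, 0) + (0, q, r) := by simp [two_smul]
    rw [this, map_add, hxpq, hx (0, q, r) rfl (hyqr 0), add_zero]
  · have : (p, (2 : F) • q, r) = (p, q, r) + (0, q, 0) := by simp [two_smul]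
    rw [this, map_add, hzq, hz (p, q, r) (hwpq r) (hyqr p), add_zero]

/-- A linear network code for the network: the vectors `L l` carried by the bottleneck edges vanish
when all inputs of `l` do, and the demanded messages vanish when all inputs of the terminal do. -/
theorem eq_zero_of_linear_solution [FiniteDimensional F V] (L : Link → (Msg → V) →ₗ[F] V)
    (hL : ∀ l x, (∀ m ∈ linkMsgs l, x m = 0) → (∀ l' ∈ linkLinks l, L l' x = 0) → L l x = 0)
    (hT : ∀ t x, (∀ m ∈ termMsgs t, x m = 0) → (∀ l ∈ termLinks t, L l x = 0) →
      x (termDemand t) = 0) (r : V) : r = 0 := by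
  let π₁ : V × V × V →ₗ[F] V := LinearMap.fst F V (V × V)
  let π₂ : V × V × V →ₗ[F] V := LinearMap.fst F V V ∘ₗ LinearMap.snd F V (V × V)
  let π₃ : V × V × V →ₗ[F] V := LinearMap.snd F V V ∘ₗ LinearMap.snd F V (V × V)
  let left : V × V × V →ₗ[F] (Msg → V) := LinearMap.pi
    fun | a => π₁ | b => π₂ | c => π₃ | d => 0 | e => 0
  -- Both embeddings put `c` in the third slot, so that the two non-Fano copies can be given the
  -- same `r`.
  let right : V × V × V →ₗ[F] (Msg → V) := LinearMap.pi
    fun | a => 0 | b => 0 | c => π₃ | d => π₁ | e => π₂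
  by_contra hr
  have h2 : (2 : F) = 0 := by
    refine (smul_eq_zero.1 (two_smul_eq_zero_of_fano (w := L fanoW ∘ₗ left) (x := L fanoX ∘ₗ left)
      (y := L fanoY ∘ₗ left) (z := L fanoZ ∘ₗ left)
      (fun r => hL _ _ (by simp [linkMsgs, left, π₁, π₂]) (by simp [linkLinks]))
      (fun p => hL _ _ (by simp [linkMsgs, left, π₂, π₃]) (by simp [linkLinks]))
      (fun v h h' => hL _ _ (by simpa [linkMsgs, left, π₁] using h) (by simpa [linkLinks] using h'))
      (fun v h h' => hL _ _ (by simp [linkMsgs]) (by simpa [linkLinks] using ⟨h, h'⟩))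
      (fun v h h' => hT fanoC (left v) (by simp [termMsgs]) (by simpa [termLinks] using ⟨h, h'⟩))
      (fun v h h' => hT fanoB (left v) (by simp [termMsgs]) (by simpa [termLinks] using ⟨h, h'⟩))
      (fun v h h' => hT fanoA (left v) (by simpa [termMsgs, left, π₃] using h')
        (by simpa [termLinks] using h)) r)).resolve_right hr
  obtain ⟨p, q, hx₁, hy₁, hz₁⟩ := exists_nonFano_eq_zero h2 (w := L leftW ∘ₗ left)
    (x := L leftX ∘ₗ left) (y := L leftY ∘ₗ left) (z := L leftZ ∘ₗ left)
    (fun r => hL _ _ (by simp [linkMsgs, left, π₁, π₂, π₃]) (by simp [linkLinks]))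
    (fun r => hL _ _ (by simp [linkMsgs, left, π₁, π₂, π₃]) (by simp [linkLinks]))
    (fun r => hL _ _ (by simp [linkMsgs, left, π₁, π₂, π₃]) (by simp [linkLinks]))
    (fun v h h' => hT leftC (left v) (by simp [termMsgs]) (by simpa [termLinks] using ⟨h, h'⟩))
    (fun v h h' => hT leftB (left v) (by simp [termMsgs]) (by simpa [termLinks] using ⟨h, h'⟩))
    (fun v h h' => hT leftA (left v) (by simp [termMsgs]) (by simpa [termLinks] using ⟨h, h'⟩)) r
  obtain ⟨s, t, hx₂, hy₂, hz₂⟩ := exists_nonFano_eq_zero h2 (w := L rightW ∘ₗ right)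
    (x := L rightX ∘ₗ right) (y := L rightY ∘ₗ right) (z := L rightZ ∘ₗ right)
    (fun r => hL _ _ (by simp [linkMsgs, right, π₁, π₂, π₃]) (by simp [linkLinks]))
    (fun r => hL _ _ (by simp [linkMsgs, right, π₁, π₂, π₃]) (by simp [linkLinks]))
    (fun r => hL _ _ (by simp [linkMsgs, right, π₁, π₂, π₃]) (by simp [linkLinks]))
    (fun v h h' => hT rightC (right v) (by simp [termMsgs]) (by simpa [termLinks] using ⟨h, h'⟩))
    (fun v h h' => hT rightE (right v) (by simp [termMsgs]) (by simpa [termLinks] using ⟨h, h'⟩))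
    (fun v h h' => hT rightD (right v) (by simp [termMsgs]) (by simpa [termLinks] using ⟨h, h'⟩)) r
  -- The two zero patterns share only `c`, where both equal `r`, so they glue to one assignment.
  let v : Msg → V := fun | a => p | b => q | c => r | d => s | e => t
  have congr {l : Link} {u : Msg → V} (hl : linkLinks l = ∅) (hu : L l u = 0)
      (h : ∀ m ∈ linkMsgs l, v m = u m) : L l v = 0 := by
    have := hL l (v - u) (fun m hm => by simp [h m hm]) (by simp [hl])
    rwa [map_sub, hu, sub_zero] at this
  refine hr (hT lastC v (by simp [termMsgs]) ?_)
  simp only [termLinks, Finset.mem_insert, Finset.mem_singleton, forall_eq_or_imp, forall_eq]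
  refine ⟨congr rfl hx₁ ?_, congr rfl hy₁ ?_, congr rfl hz₁ ?_, congr rfl hx₂ ?_, congr rfl hy₂ ?_,
    congr rfl hz₂ ?_⟩ <;> simp [linkMsgs, left, right, v, π₁, π₂, π₃]

/-- The network has no vector linear solution. -/
theorem lt_length_of_isLinearCode {n ℓ : ℕ} (hn : 0 < n)
    {f : (Msg ⊕ Edge → Fin n → F) →ₗ[F] (Fin ℓ → F)}
    (hf : network.indexInstance.IsLinearCode n F ℓ f) : n * Nat.card Edge < ℓ := by
  by_contra! hℓ
  obtain ⟨φ, hin, hedge, hout⟩ := network.exists_linear_networkCode hf hℓ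
  have hhub {m : Msg} {s : Node} (hs : Adj (hub m) s) (hne : ∀ m', s ≠ hub m')
      {x : Msg → Fin n → F} (hx : x m = 0) : φ x ⟨(hub m, s), hs⟩ = 0 := by
    refine hedge _ (by rw [not_isInput_iff]; simp) x ?_
    rintro ⟨⟨s', t'⟩, h'⟩ rfl
    cases s' <;> simp only [network, Adj] at h'
    subst h'
    exact hin _ x hx
  have hlink {l : Link} {s : Node} (hs : Adj (linkOut l) s)
      {x : Msg → Fin n → F} (hx : φ x ⟨(linkIn l, linkOut l), rfl⟩ = 0) :
      φ x ⟨(linkOut l, s), hs⟩ = 0 := by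
    refine hedge _ (by rw [not_isInput_iff]; simp) x ?_
    rintro ⟨⟨s', t'⟩, h'⟩ rfl
    cases s' <;> simp only [network, Adj] at h'
    subst h'
    exact hx
  -- Since `n > 0`, the constant vector `1` is nonzero and contradicts the triviality of all
  -- messages.
  have h1 := eq_zero_of_linear_solution
    (fun l => LinearMap.proj ⟨(linkIn l, linkOut l), rfl⟩ ∘ₗ φ) ?_ ?_ (fun _ : Fin n => (1 : F))
  · exact one_ne_zero (congrFun h1 ⟨0, hn⟩)
  · intro l x hm hl
    refine hedge _ (by rw [not_isInput_iff]; simp) x ?_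
    rintro ⟨⟨s, t⟩, h⟩ hp
    change t = linkIn l at hp
    subst hp
    rcases s with m | m | l' | l' | t' | t' <;> try exact h.elim
    · exact hhub h (by simp) (hm m h)
    · exact hlink h (hl l' h)
  · intro t x hm hl
    have ho : network.IsOutput (⟨(terminal t, sink t), rfl⟩ : Edge) :=
      (isOutput_iff ⟨(terminal t, sink t), rfl⟩).2 ⟨t, rfl⟩
    refine hout _ ho x (hedge _ (by rw [not_isInput_iff]; simp) x ?_)
    rintro ⟨⟨s, t'⟩, h⟩ hp
    change t' = terminal t at hp
    subst hp
    rcases s with m | m | l' | l' | t' | t' <;> try exact h.elim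
    · exact hhub h (by simp) (hm m h)
    · exact hlink h (hl l' h)

end Linear

/-! ### Comparison of the rates -/

theorem rate_two_four_eq_mu : network.indexInstance.rate 2 4 = network.indexInstance.mu := by
  have h1 := network.indexInstance.mul_mu_le_length (n := 2) (q := 4) (by norm_num)
  have h2 := isNetworkCode.length_le 2
  have h3 := network.card_le_mu
  have h : network.indexInstance.length 2 4 = 2 * network.indexInstance.mu := by omega
  rw [IndexInstance.rate, h]
  push_cast
  ring

/-- The code over four symbols bounds `mu` from above, with no need to examine the side-information
sets. -/
theorem mu_le_card : network.indexInstance.mu ≤ Nat.card Edge := by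
  have h1 := network.indexInstance.mul_mu_le_length (n := 2) (q := 4) (by norm_num)
  have h2 := isNetworkCode.length_le 2
  omega

end DFZ

theorem corollary12 :
    DFZ.network.indexInstance.rate 2 4 = DFZ.network.indexInstance.mu ∧
    ∀ (n : ℕ), 0 < n → ∀ (F : Type*) [Field F] [Finite F],
      DFZ.network.indexInstance.rate 2 4 < DFZ.network.indexInstance.linearRate n F := by
  refine ⟨DFZ.rate_two_four_eq_mu, fun n hn F _ _ => ?_⟩
  have hmem : DFZ.network.indexInstance.linearLength n F ∈
      {ℓ : ℕ | ∃ f : (DFZ.Msg ⊕ DFZ.Edge → Fin n → F) →ₗ[F] (Fin ℓ → F),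
        DFZ.network.indexInstance.IsLinearCode n F ℓ f} :=
    Nat.sInf_mem (DFZ.network.indexInstance.exists_linearCode n F)
  obtain ⟨f, hf⟩ := hmem
  have hlt := (Nat.mul_le_mul_left n DFZ.mu_le_card).trans_lt (DFZ.lt_length_of_isLinearCode hn hf)
  rw [DFZ.rate_two_four_eq_mu, IndexInstance.linearRate, lt_div_iff₀ (by exact_mod_cast hn),
    mul_comm]
  exact_mod_cast hlt
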